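/- **Connecting Lemma.** Let $r\ge 2$ be an integer and let $\mu>0$. There exist $\alpha>0$ and $n_0\in\mathbb N$ (depending only on $r$ and $\mu$) such that the following holds for every finite simple graph $G$ on $n\ge n_0$ vertices with minimum degree $\delta(G)\ge\left(1-\frac1r+\mu\right)n$ and independence number $\alpha(G)\le\alpha n$. For any two disjoint ordered $r$-tuples of vertices $\mathbf x=(x_1,\dots,x_r)$ and $\mathbf y=(y_1,\dots,y_r)$, each inducing a copy of $K_r$ in $G$, there is an $r$-path $P=v_1v_2\dots v_\ell$ in $G$ with $r\le\ell\le 200r^5$ that connects $\mathbf x$ and $\mathbf y$. Here an *$r$-path* in $G$ is a sequence $v_1v_2\dots v_\ell$ of distinct vertices such that $v_iv_j\in E(G)$ whenever $1\le i<j\le\ell$ and $j-i\le r$ (that is, a not necessarily induced copy of the $r$-th power of a path), and such an $r$-path $P$ *connects* $\mathbf x$ and $\mathbf y$ if it is vertex-disjoint from $\mathbf x$ and from $\mathbf y$ and, for every $i\in\{1,\dots,r\}$, the vertex $v_i$ is adjacent to all of $x_i,\dots,x_r$ and the vertex $y_i$ is adjacent to all of $v_{\ell-r+i},\dots,v_\ell$.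 -/

import Mathlib

namespace SimpleGraph

/-- The vertices of the tuple `x` are distinct and pairwise adjacent, that is, the `r`-tuple `x`
induces a copy of `K_r` in `G`. (Distinctness follows since `G.Adj` is irreflexive.) -/
def IsCliqueTuple {V : Type*} (G : SimpleGraph V) {r : ℕ} (x : Fin r → V) : Prop :=
  Pairwise fun i j => G.Adj (x i) (x j)

/-- The sequence `v` of `l` distinct vertices is an `r`-path in `G` (a copy, not necessarily
induced, of the `r`-th power of a path): any two vertices whose positions differ by at most `r`
are adjacent. -/
structure IsRPath {V : Type*} (G : SimpleGraph V) (r : ℕ) {l : ℕ} (v : Fin l → V) : Prop where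
  injective : Function.Injective v
  adj : ∀ i j : Fin l, i < j → (j : ℕ) ≤ (i : ℕ) + r → G.Adj (v i) (v j)

/-- The `r`-path `v` connects the `r`-tuples `x` and `y`: it has at least `r` vertices, is disjoint
from `x` and from `y`, its `i`-th vertex is a common neighbour of the entries of `x` from the `i`-th
one on, and the `i`-th entry of `y` is a common neighbour of the vertices of `v` from the
`(l - r + i)`-th one on, for each of the `r` positions `i`. -/
structure IsConnectingRPath {V : Type*} (G : SimpleGraph V) {r l : ℕ} (x y : Fin r → V)
    (v : Fin l → V) : Prop where
  isRPath : G.IsRPath r v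
  le_length : r ≤ l
  disjoint_left : Disjoint (Set.range v) (Set.range x)
  disjoint_right : Disjoint (Set.range v) (Set.range y)
  adj_left : ∀ (i : Fin r) (j : Fin r), i ≤ j → G.Adj (x j) (v (Fin.castLE le_length i))
  adj_right : ∀ (i : Fin r) (j : Fin l), l - r + (i : ℕ) ≤ (j : ℕ) → G.Adj (v j) (y i)

end SimpleGraph

/-! A vertex misses at most `(1/r - μ)n` vertices, so any `r` vertices have at least `rμn` common
neighbours (`le_card_commonNeighbors`). Hence a bounded pattern in which each label sees at most `r`
roots or earlier labels is realised by a positive proportion of all assignments, and so is its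
blow-up with boundedly many clones of each label (`exists_le_card_filter_blowUp`).

The pattern is a staircase with `r` columns. A row gives a block of `r + 1` consecutive positions:
column `0` fills two of them, every other column one. Row `0` attaches to `x`. From row `j` to row
`j + 1`, column `j` switches to its core label, so row `r` is the core clique. The second side does
the same from `y`, read backwards, and the two sides meet in the core. Positions at distance at most
`r` lie in different columns, except inside column `0`.

Edges between clones of one label are therefore needed only in column `0`: a path of clones of `inl
0`, and one edge at each first entry. They come from the small independence number. In any vertex
set, all but few vertices have many neighbours in it and start a long path in it. The set of
admissible further clones does not depend on the clone itself, so a random blow-up has a clone that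
works (`exists_isStairEmbedding`). The rest is the arithmetic of positions in the sequence. -/

open Finset Function

/-! ### Counting assignments: resampling, greedy choice, blow-up -/

section Counting

open scoped Classical in
/-- Counting assignments by resampling one coordinate. -/
theorem card_mul_card_filter_update {ι V : Type*} [Fintype ι] [DecidableEq ι] [Fintype V] (i : ι)
    (Q : (ι → V) → V → Prop) (hQ : ∀ φ w v, Q (update φ i w) v ↔ Q φ v) :
    #{φ : ι → V | Q φ (φ i)} * Fintype.card V = ∑ φ : ι → V, #{w : V | Q φ w} := by
  have h1 : #{φ : ι → V | Q φ (φ i)} * Fintype.card V =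
      #(({φ : ι → V | Q φ (φ i)} : Finset (ι → V)) ×ˢ (univ : Finset V)) := by
    rw [card_product, card_univ]
  have h2 : ∑ φ : ι → V, #{w : V | Q φ w} =
      #((univ : Finset (ι → V)).sigma fun φ => ({w : V | Q φ w} : Finset V)) := by
    rw [card_sigma]
  rw [h1, h2]
  -- Exchanging the value at `i` with the resampled value is an involution.
  refine card_nbij' (fun p => ⟨update p.1 i p.2, p.1 i⟩) (fun p => (update p.1 i p.2, p.1 i))
    ?_ ?_ ?_ ?_
  · rintro ⟨φ, w⟩ h
    simpa [hQ] using h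
  · rintro ⟨φ, w⟩ h
    simpa [hQ] using h
  · rintro ⟨φ, w⟩ -
    simp
  · rintro ⟨φ, w⟩ -
    simp

-- Fix all coordinates but `i`: the conditional proportion is at most `b`, hence so is the average.
-- This bounds the bad events, whose condition on coordinate `i` is set by the other coordinates.
open scoped Classical in
theorem card_filter_apply_le {ι V : Type*} [Fintype ι] [DecidableEq ι] [Fintype V] [Nonempty V] (i : ι)
    (Q : (ι → V) → V → Prop) (hQ : ∀ φ w v, Q (update φ i w) v ↔ Q φ v) (b : ℝ)
    (hb : ∀ φ, (#{w : V | Q φ w} : ℝ) ≤ b * Fintype.card V) :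
    (#{φ : ι → V | Q φ (φ i)} : ℝ) ≤ b * Fintype.card (ι → V) := by
  have h := card_mul_card_filter_update i Q hQ
  have hn : (0 : ℝ) < Fintype.card V := by exact_mod_cast Fintype.card_pos
  have h' : (#{φ : ι → V | Q φ (φ i)} : ℝ) * Fintype.card V = ∑ φ : ι → V, (#{w : V | Q φ w} : ℝ) := by
    exact_mod_cast h
  have h2 : ∑ φ : ι → V, (#{w : V | Q φ w} : ℝ) ≤ ∑ _φ : ι → V, b * Fintype.card V :=
    sum_le_sum fun φ _ => hb φ
  rw [← h', sum_const, nsmul_eq_mul, card_univ, ← mul_assoc] at h2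
  rw [mul_comm b]
  exact le_of_mul_le_mul_right h2 hn

-- The lower-bound counterpart: given `P`, which ignores coordinate `i`, a fresh value there
-- succeeds with proportion at least `c`. It drives the inductions that choose coordinates one by
-- one.
open scoped Classical in
theorem le_card_filter_and_apply {ι V : Type*} [Fintype ι] [DecidableEq ι] [Fintype V] [Nonempty V] (i : ι)
    (P : (ι → V) → Prop) (hP : ∀ φ w, P (update φ i w) ↔ P φ)
    (Q : (ι → V) → V → Prop) (hQ : ∀ φ w v, Q (update φ i w) v ↔ Q φ v) (c : ℝ)
    (hc : ∀ φ, P φ → c * Fintype.card V ≤ #{w : V | Q φ w}) :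
    c * #{φ : ι → V | P φ} ≤ #{φ : ι → V | P φ ∧ Q φ (φ i)} := by
  have h := card_mul_card_filter_update i (fun φ v => P φ ∧ Q φ v) (by simp [hP, hQ])
  have hn : (0 : ℝ) < Fintype.card V := by exact_mod_cast Fintype.card_pos
  have h' : (#{φ : ι → V | P φ ∧ Q φ (φ i)} : ℝ) * Fintype.card V =
      ∑ φ : ι → V, (#{w : V | P φ ∧ Q φ w} : ℝ) := by
    rw [← Nat.cast_mul, ← Nat.cast_sum, Nat.cast_inj]
    convert h
  have h2 : ∑ φ : ι → V with P φ, c * Fintype.card V ≤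
      ∑ φ : ι → V, (#{w : V | P φ ∧ Q φ w} : ℝ) := by
    rw [sum_filter]
    refine sum_le_sum fun φ _ => ?_
    split_ifs with hφ
    · simpa [hφ] using hc φ hφ
    · positivity
  rw [← h', sum_const, nsmul_eq_mul, ← mul_assoc] at h2
  rw [mul_comm c]
  exact le_of_mul_le_mul_right h2 hn

open scoped Classical in
/-- If the coordinates in `s` can be chosen one after the other, in the order of `rank`, each with
at least `c * card V` choices, then there are many assignments. -/
theorem le_card_filter_of_rank {ι V : Type*} [Fintype ι] [DecidableEq ι] [Fintype V] [Nonempty V]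
    (rank : ι → ℕ) (Q : ι → (ι → V) → V → Prop)
    (hQ : ∀ i j, rank i ≤ rank j → ∀ φ w v, Q i (update φ j w) v ↔ Q i φ v)
    {c : ℝ} (hc : 0 ≤ c) (h : ∀ i φ, c * Fintype.card V ≤ #{v : V | Q i φ v}) (s : Finset ι) :
    c ^ #s * Fintype.card (ι → V) ≤ #{φ : ι → V | ∀ i ∈ s, Q i φ (φ i)} := by
  induction s using Finset.induction_on_max_value rank with
  | empty => simp
  | insert a s ha hmax ih =>
    have := le_card_filter_and_apply a (fun φ => ∀ i ∈ s, Q i φ (φ i))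
      (fun φ w => forall₂_congr fun i hi => by
        rw [hQ i a (hmax i hi), update_of_ne (ne_of_mem_of_not_mem hi ha)])
      (Q a) (hQ a a le_rfl) c (fun φ _ => h a φ)
    have e : #{φ : ι → V | ∀ i ∈ insert a s, Q i φ (φ i)} =
        #{φ : ι → V | (∀ i ∈ s, Q i φ (φ i)) ∧ Q a φ (φ a)} := by
      congr 1; ext φ; simp [and_comm]
    rw [e, card_insert_of_notMem ha, pow_succ']
    calc _ = c * (c ^ #s * Fintype.card (ι → V)) := by ring
      _ ≤ _ := mul_le_mul_of_nonneg_left ih hc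
      _ ≤ _ := by convert this

open scoped Classical in
/-- Cloning one coordinate `i₀`: if `P` holds for many assignments and does not depend on the
coordinates in `J` apart from `i₀`, then for many assignments `P` holds after moving any of the
coordinates in `J` to `i₀`. -/
theorem le_card_filter_clone {ι V : Type*} [Fintype ι] [DecidableEq ι] [Fintype V] [Nonempty V]
    (P : (ι → V) → Prop) (i₀ : ι) (J : Finset ι)
    (hP : ∀ j ∈ J, j ≠ i₀ → ∀ φ w, P (update φ j w) ↔ P φ) {c : ℝ} (hc : 0 ≤ c)
    (h : c * Fintype.card (ι → V) ≤ #{φ : ι → V | P φ}) :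
    (c / 2) ^ (#J + 1) * Fintype.card (ι → V) ≤
      #{φ : ι → V | ∀ j ∈ J, P (update φ i₀ (φ j))} := by
  have hn : (0 : ℝ) < Fintype.card V := by exact_mod_cast Fintype.card_pos
  -- By averaging, a proportion `c / 2` of the assignments is good. Given goodness, each coordinate
  -- in `J` succeeds in turn with proportion `c / 2`, hence the exponent `#J + 1`.
  set good : (ι → V) → Prop := fun φ => c / 2 * Fintype.card V ≤ #{w : V | P (update φ i₀ w)}
    with hgood
  have hcomm : ∀ j ∈ J, ∀ φ w v, P (update (update φ j w) i₀ v) ↔ P (update φ i₀ v) := by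
    intro j hj φ w v
    by_cases hji : j = i₀
    · subst hji; simp
    · rw [update_comm hji, hP j hj hji]
  have hgood_count : c / 2 * Fintype.card (ι → V) ≤ #{φ : ι → V | good φ} := by
    have h1 := card_mul_card_filter_update i₀ (fun φ w => P (update φ i₀ w)) (by simp)
    simp only [update_eq_self] at h1
    have h2 : (#{φ : ι → V | P φ} : ℝ) * Fintype.card V =
      ∑ φ : ι → V, (#{w : V | P (update φ i₀ w)} : ℝ) := by exact_mod_cast h1
    have h3 : ∑ φ : ι → V, (#{w : V | P (update φ i₀ w)} : ℝ) ≤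
        ∑ φ : ι → V, ((if good φ then (Fintype.card V : ℝ) else 0) + c / 2 * Fintype.card V) := by
      refine sum_le_sum fun φ _ => ?_
      split_ifs with hφ
      · have : (#{w : V | P (update φ i₀ w)} : ℝ) ≤ Fintype.card V := by
          exact_mod_cast card_le_univ _
        have : 0 ≤ c / 2 * Fintype.card V := by positivity
        linarith
      · have := not_le.1 hφ
        linarith
    rw [← h2, sum_add_distrib, ← sum_filter, sum_const, sum_const, nsmul_eq_mul, nsmul_eq_mul,
      card_univ, ← mul_assoc, ← add_mul] at h3
    have := le_of_mul_le_mul_right h3 hn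
    linarith
  have key : ∀ J' ⊆ J, (c / 2) ^ (#J' + 1) * Fintype.card (ι → V) ≤
      #{φ : ι → V | good φ ∧ ∀ j ∈ J', P (update φ i₀ (φ j))} := by
    intro J'
    induction J' using Finset.induction_on with
    | empty => intro _; simpa using hgood_count
    | insert a s ha ih =>
      intro hsub
      have haJ : a ∈ J := hsub (mem_insert_self _ _)
      have := le_card_filter_and_apply a
        (fun φ => good φ ∧ ∀ j ∈ s, P (update φ i₀ (φ j)))
        (fun φ w => by
          refine and_congr (by simp only [hgood, hcomm a haJ]) (forall₂_congr fun j hj => ?_)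
          rw [hcomm a haJ, update_of_ne (ne_of_mem_of_not_mem hj ha)])
        (fun φ w => P (update φ i₀ w)) (fun φ w v => hcomm a haJ φ w v) (c / 2)
        (fun φ hφ => hφ.1)
      have e : #{φ : ι → V | good φ ∧ ∀ j ∈ insert a s, P (update φ i₀ (φ j))} =
          #{φ : ι → V | (good φ ∧ ∀ j ∈ s, P (update φ i₀ (φ j))) ∧ P (update φ i₀ (φ a))} := by
        congr 1; ext φ; simp only [mem_filter, mem_univ, true_and, forall_mem_insert]; tauto
      rw [e, card_insert_of_notMem ha, pow_succ']
      calc _ = c / 2 * ((c / 2) ^ (#s + 1) * Fintype.card (ι → V)) := by ring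
        _ ≤ _ := mul_le_mul_of_nonneg_left (ih ((subset_insert _ _).trans hsub)) (by positivity)
        _ ≤ _ := by convert this
  refine (key J subset_rfl).trans ?_
  exact_mod_cast card_le_card fun φ => by
    simp only [mem_filter, mem_univ, true_and]
    exact fun h => h.2

open scoped Classical in
/-- Blow-up: if `A` holds for a positive proportion of the assignments `u (·, a₀)`, then for a
positive proportion of the assignments `u` it holds for every selection of one clone of each
label. -/
theorem exists_le_card_filter_blowUp.{u, v, w} (ι : Type u) (κ : Type v) [Fintype ι] [DecidableEq ι] [Fintype κ] [DecidableEq κ] (a₀ : κ)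
    {c : ℝ} (hc : 0 < c) :
    ∃ c' : ℝ, 0 < c' ∧ ∀ (V : Type w) [Fintype V] [Nonempty V] (A : (ι → V) → Prop),
      c * Fintype.card (ι × κ → V) ≤ #{u : ι × κ → V | A fun i => u (i, a₀)} →
      c' * Fintype.card (ι × κ → V) ≤
        #{u : ι × κ → V | ∀ σ : ι → κ, A fun i => u (i, σ i)} := by
  suffices H : ∀ s : Finset ι, ∃ c' : ℝ, 0 < c' ∧
      ∀ (V : Type w) [Fintype V] [Nonempty V] (A : (ι → V) → Prop),
      c * Fintype.card (ι × κ → V) ≤ #{u : ι × κ → V | A fun i => u (i, a₀)} →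
      c' * Fintype.card (ι × κ → V) ≤
        #{u : ι × κ → V | ∀ σ : ι → κ, (∀ i ∉ s, σ i = a₀) → A fun i => u (i, σ i)} by
    obtain ⟨c', hc', h⟩ := H univ
    exact ⟨c', hc', fun V _ _ A hA => (h V A hA).trans (by simp)⟩
  intro s
  induction s using Finset.induction_on with
  | empty =>
    refine ⟨c, hc, fun V _ _ A h => h.trans ?_⟩
    exact_mod_cast card_le_card fun u => by
      simp only [mem_filter, mem_univ, true_and]
      intro hu σ hσ
      simpa [hσ] using hu
  | insert i s hi ih =>
    obtain ⟨c', hc', ih⟩ := ih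
    refine ⟨(c' / 2) ^ (#((univ : Finset κ).image fun a => (i, a)) + 1), by positivity,
      fun V _ _ A h => ?_⟩
    have hclone := le_card_filter_clone
      (fun u : ι × κ → V => ∀ σ : ι → κ, (∀ i ∉ s, σ i = a₀) → A fun i => u (i, σ i))
      (i, a₀) ((univ : Finset κ).image fun a => (i, a)) ?_ hc'.le (by convert ih V A h)
    · refine hclone.trans ?_
      exact_mod_cast card_le_card fun u => by
        simp only [mem_filter, mem_univ, true_and]
        intro hu σ hσ
        -- The clone `σ i` has been moved into the place of `a₀`, so the old condition is used for
        -- `σ` reset to `a₀` at `i`.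
        have := hu (i, σ i) (mem_image_of_mem _ (mem_univ _)) (update σ i a₀) (fun i' hi' => by
          by_cases h : i' = i
          · subst h; simp
          · rw [update_of_ne h]; exact hσ i' (by simp [h, hi']))
        convert this using 2 with i'
        by_cases h : i' = i
        · subst h; simp
        · rw [update_of_ne h, update_of_ne (by simp [h])]
    · intro j hj hne φ w
      obtain ⟨a, -, rfl⟩ := mem_image.1 hj
      have hne' : ∀ σ : ι → κ, (∀ i ∉ s, σ i = a₀) → ∀ i', (i', σ i') ≠ (i, a) := by
        rintro σ hσ i' h
        obtain ⟨rfl, h⟩ := Prod.mk.inj h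
        rw [hσ _ hi] at h
        exact hne (by rw [h])
      refine forall₂_congr fun σ hσ => ?_
      simp only [update_of_ne (hne' σ hσ _)]

end Counting

/-! ### Consequences of small independence number and large minimum degree -/

namespace SimpleGraph

open scoped Classical in
theorem exists_maximal_isIndepSet_subset {V : Type*} (G : SimpleGraph V) (S : Finset V) :
    ∃ I ⊆ S, G.IsIndepSet (I : Set V) ∧ ∀ w ∈ S \ I, ∃ v ∈ I, G.Adj w v := by
  obtain ⟨I, hI, hmax⟩ := exists_max_image (S.powerset.filter fun I : Finset V => G.IsIndepSet (I : Set V)) card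
    ⟨∅, by simp [IsIndepSet]⟩
  simp only [mem_filter, mem_powerset] at hI hmax
  refine ⟨I, hI.1, hI.2, fun w hw => ?_⟩
  rw [mem_sdiff] at hw
  by_contra! hno
  have := hmax (insert w I) ⟨insert_subset hw.1 hI.1, by
    rw [coe_insert]
    refine hI.2.insert fun v hv _ => ⟨hno v hv, fun h => hno v hv h.symm⟩⟩
  rw [card_insert_of_notMem hw.2] at this
  omega

open scoped Classical in
/-- If independent sets have at most `a` vertices, then all but few vertices of `S` have many
neighbours in `S`. -/
theorem card_filter_degree_lt_le {V : Type*} (G : SimpleGraph V) {a : ℕ}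
    (ha : ∀ I : Finset V, G.IsIndepSet (I : Set V) → #I ≤ a) (m : ℕ) (S : Finset V) :
    #{w ∈ S | #{v ∈ S | G.Adj w v} < m} ≤ m * a := by
  induction m generalizing S with
  | zero => simp
  | succ m ih =>
    obtain ⟨I, hIS, hI, hmax⟩ := G.exists_maximal_isIndepSet_subset S
    -- Each vertex outside the maximal independent set `I` has a neighbour in `I`, so removing `I`
    -- lowers its degree.
    have hsub : ({w ∈ S | #{v ∈ S | G.Adj w v} < m + 1} : Finset V) ⊆
        I ∪ {w ∈ S \ I | #{v ∈ S \ I | G.Adj w v} < m} := by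
      intro w hw
      rw [mem_filter] at hw
      by_cases hwI : w ∈ I
      · exact mem_union_left _ hwI
      refine mem_union_right _ (mem_filter.2 ⟨mem_sdiff.2 ⟨hw.1, hwI⟩, ?_⟩)
      obtain ⟨v, hv, hwv⟩ := hmax w (mem_sdiff.2 ⟨hw.1, hwI⟩)
      have : insert v ({v ∈ S \ I | G.Adj w v} : Finset V) ⊆ {v ∈ S | G.Adj w v} := by
        refine insert_subset (mem_filter.2 ⟨hIS hv, hwv⟩) ?_
        exact filter_subset_filter _ sdiff_subset
      have := card_le_card this
      rw [card_insert_of_notMem (by simp [hv])] at this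
      omega
    calc _ ≤ _ := card_le_card hsub
      _ ≤ _ := card_union_le _ _
      _ ≤ a + m * a := add_le_add (ha I hI) (ih _)
      _ = _ := by ring

/-- The vertices `q 0, …, q m` form a path in `S` that starts in `w`. -/
structure IsPathSeq {V : Type*} (G : SimpleGraph V) (S : Finset V) (m : ℕ) (w : V) (q : ℕ → V) :
    Prop where
  zero : q 0 = w
  injOn : Set.InjOn q (Set.Iic m)
  mem : ∀ k ≤ m, q k ∈ S
  adj : ∀ k < m, G.Adj (q k) (q (k + 1))

open scoped Classical in
/-- If independent sets have at most `a` vertices, then all but few vertices of `S` start a path of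
given length in `S`. -/
theorem card_filter_not_isPathSeq_le {V : Type*} (G : SimpleGraph V) {a : ℕ}
    (ha : ∀ I : Finset V, G.IsIndepSet (I : Set V) → #I ≤ a) (m : ℕ) (S : Finset V) :
    #{w ∈ S | ¬ ∃ q, G.IsPathSeq S m w q} ≤ m * a := by
  induction m generalizing S with
  | zero =>
    rw [zero_mul, Nat.le_zero, card_eq_zero, filter_eq_empty_iff]
    intro w hw
    rw [not_not]
    exact ⟨fun _ => w, rfl, fun i hi j hj _ => by simp at hi hj; omega, fun _ _ => hw, by simp⟩
  | succ m ih =>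
    obtain ⟨I, hIS, hI, hmax⟩ := G.exists_maximal_isIndepSet_subset S
    -- A path in `S \ I` extends by a neighbour of its last vertex in `I`, which is automatically
    -- new.
    have hsub : ({w ∈ S | ¬ ∃ q, G.IsPathSeq S (m + 1) w q} : Finset V) ⊆
        I ∪ {w ∈ S \ I | ¬ ∃ q, G.IsPathSeq (S \ I) m w q} := by
      intro w hw
      rw [mem_filter] at hw
      by_cases hwI : w ∈ I
      · exact mem_union_left _ hwI
      refine mem_union_right _ (mem_filter.2 ⟨mem_sdiff.2 ⟨hw.1, hwI⟩, ?_⟩)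
      rintro ⟨q, hq⟩
      obtain ⟨v, hv, hwv⟩ := hmax (q m) (hq.mem m le_rfl)
      have hne : ∀ k ≤ m, q k ≠ v := fun k hk h => by
        have := hq.mem k hk
        rw [h] at this
        exact (mem_sdiff.1 this).2 hv
      refine hw.2 ⟨update q (m + 1) v, ?_, ?_, ?_, ?_⟩
      · rw [update_of_ne (by omega), hq.zero]
      · intro i hi j hj h
        simp only [Set.mem_Iic] at hi hj
        rcases hi.eq_or_lt with rfl | hi <;> rcases hj.eq_or_lt with rfl | hj
        · rfl
        · rw [update_self, update_of_ne (by omega)] at h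
          exact absurd h.symm (hne j (by omega))
        · rw [update_self, update_of_ne (by omega)] at h
          exact absurd h (hne i (by omega))
        · rw [update_of_ne (by omega), update_of_ne (by omega)] at h
          exact hq.injOn (by simp; omega) (by simp; omega) h
      · intro k hk
        rcases hk.eq_or_lt with rfl | hk
        · rw [update_self]; exact hIS hv
        · rw [update_of_ne (by omega)]
          exact (mem_sdiff.1 (hq.mem k (by omega))).1
      · intro k hk
        rw [update_of_ne (by omega)]
        rcases (Nat.lt_succ_iff.1 hk).eq_or_lt with rfl | hk
        · rwa [update_self]
        · rw [update_of_ne (by omega)]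
          exact hq.adj k hk
    calc _ ≤ _ := card_le_card hsub
      _ ≤ _ := card_union_le _ _
      _ ≤ a + m * a := add_le_add (ha I hI) (ih _)
      _ = _ := by ring

open scoped Classical in
/-- Any `r` vertices have many common neighbours. -/
theorem le_card_commonNeighbors {V : Type*} [Fintype V] (G : SimpleGraph V) {r : ℕ} (hr : 0 < r)
    {μ : ℝ} (h : ∀ v, (1 - 1 / (r : ℝ) + μ) * Fintype.card V ≤ #{w | G.Adj w v})
    (g : Fin r → V) :
    r * μ * Fintype.card V ≤ #{w : V | ∀ c, G.Adj w (g c)} := by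
  have h1 : ({w : V | ∀ c, G.Adj w (g c)} : Finset V)ᶜ ⊆
      univ.biUnion fun c => ({w | G.Adj w (g c)} : Finset V)ᶜ := by
    intro w hw
    simpa using hw
  have h2 := (card_le_card h1).trans card_biUnion_le
  have h3 : (Fintype.card V : ℝ) - #{w : V | ∀ c, G.Adj w (g c)} ≤
      ∑ c : Fin r, ((Fintype.card V : ℝ) - #{w | G.Adj w (g c)}) := by
    have e : ∀ s : Finset V, (#sᶜ : ℝ) = Fintype.card V - #s := fun s => by
      rw [card_compl, Nat.cast_sub (card_le_univ _)]
    rw [← e]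
    simp_rw [← e]
    exact_mod_cast h2
  have h4 : ∑ c : Fin r, ((Fintype.card V : ℝ) - #{w | G.Adj w (g c)}) ≤
      ∑ _c : Fin r, (1 / (r : ℝ) - μ) * Fintype.card V :=
    sum_le_sum fun c _ => by linarith [h (g c)]
  rw [sum_const, card_univ, Fintype.card_fin, nsmul_eq_mul] at h4
  have hr' : (r : ℝ) ≠ 0 := by positivity
  have h5 : (r : ℝ) * ((1 / (r : ℝ) - μ) * Fintype.card V) =
      Fintype.card V - r * μ * Fintype.card V := by field_simp
  linarith

end SimpleGraph

/-! ### The staircase pattern -/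

/-- The labels of the staircase pattern: a core clique `inl c`, and for each of the two sides an
array of further labels `inr (b, j, c)` with row `j` and column `c`. -/
abbrev StairLabel (r : ℕ) : Type := Fin r ⊕ (Bool × Fin r × Fin r)

namespace StairLabel

/-- The core label of column `c`; the two sides see the core in opposite cyclic orders. -/
def core {r : ℕ} [NeZero r] (b : Bool) (c : Fin r) : StairLabel r := .inl (if b then -c else c)

/-- The entry in row `j` and column `c` of the staircase: the core has been reached in the columns
before the `j`-th one. -/
def entry {r : ℕ} [NeZero r] (b : Bool) (j : ℕ) (c : Fin r) : StairLabel r :=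
  if h : j ≤ c then .inr (b, ⟨j, h.trans_lt c.2⟩, c) else core b c

/-- The first entry of a side. -/
def apex (r : ℕ) [NeZero r] (b : Bool) : StairLabel r := .inr (b, 0, 0)

/-- The `r` earlier neighbours of a label: roots (`inl`) or labels of smaller rank (`inr`). -/
def back {r : ℕ} [NeZero r] : StairLabel r → Fin r → (Bool × Fin r) ⊕ StairLabel r
  | .inl c, c' =>
    -- The label `inl 0` sees both first entries, which joins the two sides; repetitions pad the
    -- list to length `r`.
    if c = 0 then .inr (apex r (decide (c' ≠ 0))) else .inr (.inl (if c' < c then c' else 0))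
  | .inr (b, j, c), c' =>
    if c = 0 then .inl (b, c')
    else if c' < c then .inr (entry b j c')
    -- No neighbour in the own column is needed, so this place is free for the one label that newly
    -- enters the core in row `j + 1`.
    else if c' = c then .inr (core b j)
    else if j = 0 then .inl (b, c')
    else .inr (entry b (j - 1 : ℕ) c')

/-- The order in which the labels are embedded. -/
def rank {r : ℕ} [NeZero r] : StairLabel r → ℕ
  | .inl c => 1 + c
  | .inr (_, j, c) => if c = 0 then 0 else r + 1 + j * r + c

/-- Adjacency of labels. -/
def Rel {r : ℕ} [NeZero r] (i i' : StairLabel r) : Prop :=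
  ∃ c, back i c = .inr i' ∨ back i' c = .inr i

theorem rank_core_le {r : ℕ} [NeZero r] (b : Bool) (c : Fin r) : rank (core b c) ≤ r := by
  have := (if b then -c else c).2
  simp only [core, rank]
  omega

theorem rank_entry_le {r : ℕ} [NeZero r] (b : Bool) (j : ℕ) (c : Fin r) :
    rank (entry b j c) ≤ r + 1 + j * r + c := by
  unfold entry
  split_ifs
  · simp only [rank]
    split_ifs <;> omega
  · have := rank_core_le b c
    omega

/-- This makes the pattern embeddable greedily, and `Rel` irreflexive. -/
theorem rank_lt_of_back {r : ℕ} [NeZero r] {i i' : StairLabel r} {c : Fin r}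
    (h : back i c = .inr i') : rank i' < rank i := by
  rcases i with a | ⟨b, j, a⟩
  · simp only [back] at h
    split_ifs at h with h0 h1
    · obtain rfl := Sum.inr.inj h
      simp [rank, apex]
    · obtain rfl := Sum.inr.inj h
      simp only [rank]
      omega
    · obtain rfl := Sum.inr.inj h
      simp only [rank, Fin.val_zero]
      have := Fin.val_ne_zero_iff.2 h0
      omega
  · simp only [back] at h
    split_ifs at h with h0 h1 h2 h3
    all_goals
      have e : rank (.inr (b, j, a) : StairLabel r) = r + 1 + j * r + a := if_neg h0
      have ha := Fin.val_ne_zero_iff.2 h0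
      rw [e]
      obtain rfl := Sum.inr.inj h
    · have := rank_entry_le b j c
      omega
    · have := rank_core_le b j
      omega
    · have := rank_entry_le b (j - 1 : ℕ) c
      obtain ⟨k, hk⟩ := Nat.exists_eq_succ_of_ne_zero (Fin.val_ne_zero_iff.2 h3)
      rw [hk, Nat.succ_sub_one] at this
      rw [hk, Nat.succ_sub_one, Nat.succ_mul]
      omega

theorem Rel.ne {r : ℕ} [NeZero r] {i i' : StairLabel r} (h : Rel i i') : i ≠ i' := by
  rintro rfl
  obtain ⟨c, h | h⟩ := h <;> exact (rank_lt_of_back h).false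

theorem Rel.symm {r : ℕ} [NeZero r] {i i' : StairLabel r} (h : Rel i i') : Rel i' i :=
  h.imp fun _ => Or.symm

theorem rel_core_core {r : ℕ} [NeZero r] (b : Bool) {c c' : Fin r} (h : c ≠ c') :
    Rel (core b c) (core b c') := by
  have key : ∀ a a' : Fin r, a < a' → Rel (.inl a : StairLabel r) (.inl a') := by
    intro a a' haa'
    refine ⟨a, Or.inr ?_⟩
    have : a' ≠ 0 := by rintro rfl; exact absurd haa' (Fin.not_lt_zero a)
    simp [back, this, haa']
  have hne : (if b then -c else c) ≠ (if b then -c' else c') := by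
    cases b <;> simpa using h
  rcases lt_or_gt_of_ne hne with h | h
  · exact key _ _ h
  · exact (key _ _ h).symm

theorem rel_entry_entry {r : ℕ} [NeZero r] (b : Bool) (j : ℕ) {c c' : Fin r} (h : c' < c) :
    Rel (entry b j c') (entry b j c) := by
  have h0 : c ≠ 0 := by rintro rfl; exact absurd h (Fin.not_lt_zero c')
  by_cases hj : j ≤ c
  · refine ⟨c', Or.inr ?_⟩
    rw [entry.eq_def b j c, dif_pos hj]
    simp [back, h0, h]
  · have : ¬ j ≤ c' := fun h' => hj (h'.trans h.le)
    rw [entry, entry, dif_neg hj, dif_neg this]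
    exact rel_core_core b h.ne

/-- Column `c'` of row `j + 1` is still outside the core (`c' > j`), has just entered it (`c' = j`),
or is unchanged from row `j` (`c' < j`). These cases use, respectively, the previous-row entries of
`back`, its own-column entry, and adjacency within row `j`. -/
theorem rel_entry_entry_succ {r : ℕ} [NeZero r] (b : Bool) (j : ℕ) {c c' : Fin r} (h : c' < c) :
    Rel (entry b j c) (entry b (j + 1) c') := by
  have h0 : c ≠ 0 := by rintro rfl; exact absurd h (Fin.not_lt_zero c')
  by_cases hc' : j + 1 ≤ c'
  · have h0' : c' ≠ 0 := by rintro rfl; simp at hc'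
    have hj : (⟨j + 1, hc'.trans_lt c'.2⟩ : Fin r) ≠ 0 := Fin.val_ne_zero_iff.1 (by simp)
    refine ⟨c, Or.inr ?_⟩
    rw [entry.eq_def b (j + 1) c', dif_pos hc']
    simp [back, h0', h.not_gt, h.ne', hj]
  · by_cases hcj : j < c'
    · omega
    rcases (not_lt.1 hcj).eq_or_lt with hcj | hcj
    · have hjc : j ≤ c := by have := Fin.lt_def.1 h; omega
      refine ⟨c, Or.inl ?_⟩
      have e : (⟨j, hjc.trans_lt c.2⟩ : Fin r) = c' := Fin.ext hcj.symm
      rw [entry.eq_def b j c, dif_pos hjc, entry, dif_neg hc', e]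
      simp [back, h0]
    · have e : entry b (j + 1) c' = entry b j c' := by
        rw [entry, entry, dif_neg hc', dif_neg (not_le.2 hcj)]
      rw [e]
      exact (rel_entry_entry b j h).symm

theorem rel_apex_zero {r : ℕ} [NeZero r] (hr : 2 ≤ r) (b : Bool) : Rel (apex r b) (.inl 0) := by
  cases b
  · exact ⟨0, Or.inr (by simp [back])⟩
  · refine ⟨⟨1, hr⟩, Or.inr ?_⟩
    have : (⟨1, hr⟩ : Fin r) ≠ 0 := Fin.val_ne_zero_iff.1 (by simp)
    simp [back, this]

theorem back_entry_zero {r : ℕ} [NeZero r] (b : Bool) {c c' : Fin r} (h : c < c') :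
    back (entry b 0 c) c' = .inl (b, c') := by
  have e : entry b 0 c = .inr (b, 0, c) := by
    rw [entry, dif_pos (Nat.zero_le _)]; rfl
  rw [e]
  simp [back, h.not_gt, h.ne']

theorem back_apex {r : ℕ} [NeZero r] (b : Bool) (c : Fin r) :
    back (apex r b) c = .inl (b, c) := by
  simp [back, apex]

end StairLabel

/-! ### Embedding the blown-up staircase -/

namespace SimpleGraph

open StairLabel

/-- A blown-up copy of the staircase pattern, rooted in `ρ`: the vertices `u (i, a)` are the clones
`a` of the label `i`, the vertices `q k` form a path of clones of the label `inl 0`, and `d b` is a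
clone of the first entry of side `b`, adjacent to the distinguished clone `m b` of that entry. -/
structure IsStairEmbedding {V κ : Type*} (G : SimpleGraph V) {r : ℕ} [NeZero r]
    (ρ : Bool × Fin r → V) (m : Bool → κ) (L : ℕ) (u : StairLabel r × κ → V) (q : ℕ → V)
    (d : Bool → V) : Prop where
  injective : Injective (Sum.elim u (Sum.elim (fun k : Fin L => q k) d))
  ne_root : ∀ s p, Sum.elim u (Sum.elim (fun k : Fin L => q k) d) s ≠ ρ p
  adj : ∀ (i i' : StairLabel r) (a a' : κ), Rel i i' → G.Adj (u (i, a)) (u (i', a'))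
  adj_root : ∀ (i : StairLabel r) (c : Fin r) (p : Bool × Fin r) (a : κ), back i c = .inl p → G.Adj (u (i, a)) (ρ p)
  adj_path : ∀ (i : StairLabel r) (a : κ) (k : ℕ), Rel i (.inl 0) → k < L → G.Adj (u (i, a)) (q k)
  path_adj : ∀ k, k + 1 < L → G.Adj (q k) (q (k + 1))
  adj_twin : ∀ (i : StairLabel r) (a : κ) (b : Bool), Rel i (apex r b) → i ≠ .inl 0 → G.Adj (u (i, a)) (d b)
  twin_adj : ∀ b, G.Adj (d b) (u (apex r b, m b))
  twin_root : ∀ b c, G.Adj (d b) (ρ (b, c))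

/-- All back-adjacencies of the staircase pattern hold. -/
def IsStairHom {V : Type*} (G : SimpleGraph V) {r : ℕ} [NeZero r] (ρ : Bool × Fin r → V)
    (φ : StairLabel r → V) : Prop :=
  ∀ i c, G.Adj (φ i) (Sum.elim ρ φ (back i c))

-- Greedy embedding by `rank`: every label is drawn from the common neighbourhood of `r` vertices
-- already fixed. All clones, not only `a₀`, are drawn this way, hence the exponent.
open scoped Classical in
theorem le_card_isStairHom {V κ : Type*} [Fintype V] [Nonempty V] [Fintype κ]
    (G : SimpleGraph V) {r : ℕ} [NeZero r] (ρ : Bool × Fin r → V) (a₀ : κ) {c : ℝ} (hc : 0 ≤ c)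
    (hG : ∀ g : Fin r → V, c * Fintype.card V ≤ #{w : V | ∀ j, G.Adj w (g j)}) :
    c ^ Fintype.card (StairLabel r × κ) * Fintype.card (StairLabel r × κ → V) ≤
      #{u : StairLabel r × κ → V | G.IsStairHom ρ fun i => u (i, a₀)} := by
  have := le_card_filter_of_rank (V := V) (fun x : StairLabel r × κ => rank x.1)
    (fun x u v => ∀ j, G.Adj v (Sum.elim ρ (fun i => u (i, a₀)) (back x.1 j))) ?_ hc
    (fun x u => by
      convert hG fun j => Sum.elim ρ (fun i => u (i, a₀)) (back x.1 j)) univ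
  · rw [card_univ] at this
    refine this.trans ?_
    exact_mod_cast card_le_card fun u => by
      simp only [mem_filter, mem_univ, true_and]
      intro hu i j
      exact hu (i, a₀) trivial j
  · rintro ⟨i, a⟩ ⟨i', a'⟩ hle u w v
    refine forall_congr' fun j => ?_
    rcases hb : back i j with p | i''
    · simp
    · have hlt := rank_lt_of_back hb
      have : (i'', a₀) ≠ (i', a') := by
        rintro h
        obtain ⟨rfl, -⟩ := Prod.mk.inj h
        simp only at hle
        omega
      simp [update_of_ne this]

open scoped Classical in
theorem exists_mem_forall_notMem {α τ : Type*} [Fintype τ] (s : Finset α) (B : τ → Finset α)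
    (h : ∑ t, (#(B t) : ℝ) < #s) : ∃ x ∈ s, ∀ t, x ∉ B t := by
  by_contra! hno
  have hsub : s ⊆ univ.biUnion B := fun x hx => by
    obtain ⟨t, ht⟩ := hno x hx
    exact mem_biUnion.2 ⟨t, mem_univ _, ht⟩
  have := (card_le_card hsub).trans card_biUnion_le
  have : (#s : ℝ) ≤ ∑ t, (#(B t) : ℝ) := by exact_mod_cast this
  linarith

/-- Related labels are distinct, so a single selection can pick `a` at `i` and `a'` at `i'`. -/
theorem IsStairHom.adj_of_forall {V κ : Type*} {G : SimpleGraph V} {r : ℕ} [NeZero r]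
    {ρ : Bool × Fin r → V} {u : StairLabel r × κ → V}
    (hu : ∀ σ : StairLabel r → κ, G.IsStairHom ρ fun i => u (i, σ i)) {i i' : StairLabel r}
    (a a' : κ) (h : Rel i i') : G.Adj (u (i, a)) (u (i', a')) := by
  classical
  obtain ⟨c, hc⟩ := h.imp fun c => id
  have hne := h.ne
  rcases hc with hc | hc
  · have := hu (update (fun _ => a') i a) i c
    simpa [hc, update_of_ne hne.symm] using this
  · have := hu (update (fun _ => a') i a) i' c
    simpa [hc, update_of_ne hne.symm] using this.symm

open scoped Classical in
/-- The possible further clones of the first entry of side `b`. -/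
noncomputable def twinSet {V κ : Type*} [Fintype V] (G : SimpleGraph V) {r : ℕ} [NeZero r]
    (ρ : Bool × Fin r → V) (u : StairLabel r × κ → V) (b : Bool) : Finset V :=
  {w | (∀ c, G.Adj w (ρ (b, c))) ∧
    ∀ i a, Rel i (apex r b) → i ≠ .inl 0 → G.Adj w (u (i, a))}

open scoped Classical in
/-- The possible further clones of the label `inl 0`, and its clone `a₀`. -/
noncomputable def pathSet {V κ : Type*} [Fintype V] (G : SimpleGraph V) {r : ℕ} [NeZero r]
    (ρ : Bool × Fin r → V) (u : StairLabel r × κ → V) (a₀ : κ) : Finset V :=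
  {w | (∀ i a, Rel i (.inl 0) → G.Adj w (u (i, a))) ∧ (∀ p, w ≠ ρ p) ∧
    ∀ x, x ≠ (.inl 0, a₀) → w ≠ u x}

/-- A label is not related to itself, so clones of the first entry impose no condition here. This
independence allows that clone to be resampled. -/
theorem twinSet_update {V κ : Type*} [Fintype V] [DecidableEq κ] (G : SimpleGraph V) {r : ℕ}
    [NeZero r] (ρ : Bool × Fin r → V) (u : StairLabel r × κ → V) (b : Bool) (a : κ) (w : V) :
    G.twinSet ρ (update u (apex r b, a) w) b = G.twinSet ρ u b := by
  ext v
  simp only [twinSet, mem_filter, mem_univ, true_and]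
  refine and_congr_right fun _ => forall₂_congr fun i a' => forall_congr' fun h => ?_
  rw [update_of_ne (fun h' => h.ne (Prod.mk.inj h').1)]

theorem pathSet_update {V κ : Type*} [Fintype V] [DecidableEq κ] (G : SimpleGraph V) {r : ℕ}
    [NeZero r] (ρ : Bool × Fin r → V) (u : StairLabel r × κ → V) (a₀ : κ) (w : V) :
    G.pathSet ρ (update u (.inl 0, a₀) w) a₀ = G.pathSet ρ u a₀ := by
  ext v
  simp only [pathSet, mem_filter, mem_univ, true_and]
  refine and_congr (forall₂_congr fun i a' => forall_congr' fun h => ?_)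
    (and_congr_right fun _ => forall₂_congr fun x hx => ?_)
  · rw [update_of_ne (fun h' => h.ne (Prod.mk.inj h').1)]
  · rw [update_of_ne hx]

/-- The staircase pattern can be completed from a generic blown-up copy of its labels. -/
theorem exists_isStairEmbedding_of_generic {V κ : Type*} [Fintype V] [Fintype κ]
    (G : SimpleGraph V) {r : ℕ} [NeZero r] (ρ : Bool × Fin r → V)
    (m : Bool → κ) (L : ℕ) (u : StairLabel r × κ → V) (a₀ : κ)
    (hu : ∀ σ : StairLabel r → κ, G.IsStairHom ρ fun i => u (i, σ i))
    (hinj : Injective u) (hroot : ∀ x p, u x ≠ ρ p)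
    (htwin : ∀ (b : Bool) (F : Finset V),
      #F ≤ Fintype.card (StairLabel r × κ) + 2 * r + L + 1 →
      ∃ w ∈ G.twinSet ρ u b, G.Adj (u (apex r b, m b)) w ∧ w ∉ F)
    (hpath : ∃ q, G.IsPathSeq (G.pathSet ρ u a₀) L (u (.inl 0, a₀)) q) :
    ∃ q d, G.IsStairEmbedding ρ m L u q d := by
  classical
  obtain ⟨q, hq⟩ := hpath
  set F : Finset V := (univ.image u ∪ univ.image ρ) ∪ (range L).image fun k => q (k + 1) with hF
  have hFcard : #F ≤ Fintype.card (StairLabel r × κ) + 2 * r + L := by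
    refine (card_union_le _ _).trans (add_le_add ((card_union_le _ _).trans
      (add_le_add card_image_le (card_image_le.trans ?_))) (card_image_le.trans (by simp)))
    simp
  obtain ⟨d₀, hd₀, hd₀', hd₀F⟩ := htwin false F (by omega)
  -- The second twin must also avoid the first; this accounts for the `+ 1` in `htwin`.
  obtain ⟨d₁, hd₁, hd₁', hd₁F⟩ := htwin true (insert d₀ F)
    ((card_insert_le _ _).trans (by omega))
  rw [mem_insert, not_or] at hd₁F
  set d : Bool → V := fun b => if b then d₁ else d₀ with hd
  have hdmem : ∀ b, d b ∈ G.twinSet ρ u b := by rintro (_ | _) <;> simpa [hd]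
  have hdadj : ∀ b, G.Adj (u (apex r b, m b)) (d b) := by rintro (_ | _) <;> simpa [hd]
  have hdF : ∀ b, d b ∉ F := by
    rintro (_ | _)
    · simpa [hd] using hd₀F
    · simpa [hd] using hd₁F.2
  simp only [hF, mem_union, mem_image, mem_univ, true_and, mem_range, not_or, not_exists,
    not_and] at hdF
  have hdinj : Injective d := by
    rintro (_ | _) (_ | _) h
    · rfl
    · exact absurd h.symm hd₁F.1
    · exact absurd h hd₁F.1
    · rfl
  have hqmem : ∀ k < L, q (k + 1) ∈ G.pathSet ρ u a₀ := fun k hk => hq.mem _ hk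
  simp only [pathSet, mem_filter, mem_univ, true_and] at hqmem
  simp only [twinSet, mem_filter, mem_univ, true_and] at hdmem
  have hqu : ∀ k < L, ∀ x, q (k + 1) ≠ u x := by
    intro k hk x
    by_cases hx : x = (.inl 0, a₀)
    · subst hx
      rw [← hq.zero]
      intro h
      have := hq.injOn (Set.mem_Iic.2 hk) (Set.mem_Iic.2 (Nat.zero_le _)) h
      omega
    · exact (hqmem k hk).2.2 x hx
  -- The start `q 0` is already a clone in `u`, so only the `L` later vertices are used.
  refine ⟨fun k => q (k + 1), d, ?_, ?_, ?_, ?_, ?_, ?_, ?_, ?_, ?_⟩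
  · refine hinj.sumElim (Injective.sumElim ?_ hdinj ?_) ?_
    · intro k k' h
      have := hq.injOn (Set.mem_Iic.2 k.2) (Set.mem_Iic.2 k'.2) h
      exact Fin.ext (by omega)
    · intro k b h
      exact (hdF b).2 k k.2 h
    · rintro x (k | b) h
      · exact hqu k k.2 x h.symm
      · exact (hdF b).1.1 x h
  · rintro (x | k | b) p
    · exact hroot x p
    · exact (hqmem k k.2).2.1 p
    · exact fun h => (hdF b).1.2 p h.symm
  · exact fun i i' a a' h => IsStairHom.adj_of_forall hu a a' h
  · intro i c p a h
    simpa [h] using hu (fun _ => a) i c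
  · exact fun i a k h hk => ((hqmem k hk).1 i a h).symm
  · exact fun k hk => hq.adj (k + 1) hk
  · exact fun i a b h h' => ((hdmem b).2 i a h h').symm
  · exact fun b => (hdadj b).symm
  · exact fun b c => (hdmem b).1 c

end SimpleGraph

open scoped Classical in
theorem card_filter_apply_mem_le {ι V : Type*} [Fintype ι] [DecidableEq ι] [Fintype V] [Nonempty V]
    (i : ι) (S : (ι → V) → Finset V) (hS : ∀ φ w, S (update φ i w) = S φ) (b : ℝ)
    (hb : ∀ φ, (#(S φ) : ℝ) ≤ b * Fintype.card V) :
    (#{φ : ι → V | φ i ∈ S φ} : ℝ) ≤ b * Fintype.card (ι → V) := by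
  have := card_filter_apply_le i (fun φ v => v ∈ S φ) (fun φ w v => by rw [hS]) b fun φ => by
    refine le_trans ?_ (hb φ)
    exact_mod_cast card_le_card fun v hv => by simpa using hv
  convert this

namespace SimpleGraph

open StairLabel

theorem exists_isStairEmbedding.{v, w} (r : ℕ) [NeZero r] (κ : Type v) [Fintype κ] [DecidableEq κ]
    (m : Bool → κ) (L : ℕ) {c : ℝ} (hc : 0 < c) :
    ∃ α : ℝ, 0 < α ∧ ∃ n₀ : ℕ, ∀ (V : Type w) [Fintype V] (G : SimpleGraph V) (a : ℕ),
      n₀ ≤ Fintype.card V →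
      (∀ g : Fin r → V, c * Fintype.card V ≤ Nat.card {w : V // ∀ j, G.Adj w (g j)}) →
      (∀ I : Finset V, G.IsIndepSet (I : Set V) → #I ≤ a) → (a : ℝ) ≤ α * Fintype.card V →
      ∀ ρ : Bool × Fin r → V, ∃ u q d, G.IsStairEmbedding ρ m L u q d := by
  classical
  set a₀ := m false
  set M := Fintype.card (StairLabel r × κ) with hM
  -- One more than the largest forbidden set, so `K` neighbours leave one to serve as twin.
  set K := M + 2 * r + L + 2 with hK
  obtain ⟨c', hc', hblow⟩ := exists_le_card_filter_blowUp.{0, v, w} (StairLabel r) κ a₀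
    (pow_pos hc M)
  -- The bad events are coincidences among the clones (`B₁`) or with roots (`B₂`), a first entry of
  -- low degree in its twin set (`B₃`), and a clone of `inl 0` starting no path (`B₄`). The choice
  -- of `n₀` makes the first two cost at most `c' / 4` together, and `α` does so for the last two.
  refine ⟨c' / (4 * (2 * K + L + 1)), by positivity, ⌈4 * (M * M + M * (2 * r)) / c'⌉₊ + 1,
    fun V _ G a hn hG ha haα ρ => ?_⟩
  have hVpos : 0 < Fintype.card V := by omega
  have : Nonempty V := Fintype.card_pos_iff.1 hVpos
  set n : ℝ := ((Fintype.card V : ℕ) : ℝ) with hn_def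
  have hn0 : 0 < n := by rw [hn_def]; exact_mod_cast hVpos
  have hn1 : 4 * (M * M + M * (2 * r)) / c' < n := by
    refine lt_of_lt_of_le ?_ (Nat.cast_le.2 hn)
    push_cast
    linarith [Nat.le_ceil (4 * (M * M + M * (2 * r)) / c' : ℝ)]
  have hG' : ∀ g : Fin r → V, c * n ≤ #{w : V | ∀ j, G.Adj w (g j)} := fun g => by
    have := hG g
    rwa [Nat.card_eq_fintype_card, Fintype.card_subtype] at this
  have hU := hblow V (G.IsStairHom ρ) (by
    convert G.le_card_isStairHom ρ a₀ hc.le hG')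
  set T : ℝ := ((Fintype.card (StairLabel r × κ → V) : ℕ) : ℝ) with hT
  have hT0 : 0 < T := by rw [hT]; exact_mod_cast Fintype.card_pos
  set U : Finset (StairLabel r × κ → V) := {u | ∀ σ : StairLabel r → κ,
    G.IsStairHom ρ fun i => u (i, σ i)} with hUdef
  let X := StairLabel r × κ
  have hone : ∀ v : V, (#{w : V | w = v} : ℝ) ≤ n⁻¹ * n := fun v => by
    rw [inv_mul_cancel₀ hn0.ne']
    exact_mod_cast card_le_one.2 fun x hx y hy => by
      rw [(mem_filter.1 hx).2, (mem_filter.1 hy).2]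
  let B₁ : X × X → Finset (X → V) := fun p => {u | p.1 ≠ p.2 ∧ u p.1 = u p.2}
  have hB₁ : ∀ p, (#(B₁ p) : ℝ) ≤ n⁻¹ * T := by
    rintro ⟨x, y⟩
    by_cases hxy : x = y
    · simp only [B₁, hxy, ne_eq, not_true_eq_false, false_and, filter_false, card_empty,
        Nat.cast_zero]
      positivity
    · have := card_filter_apply_le (V := V) x (fun u v => v = u y)
        (fun u w v => by rw [update_of_ne (Ne.symm hxy)]) n⁻¹ (fun u => by convert hone (u y))
      refine le_trans ?_ this
      exact_mod_cast card_le_card fun u => by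
        simp only [B₁, mem_filter, mem_univ, true_and]
        exact fun h => h.2
  let B₂ : X × (Bool × Fin r) → Finset (X → V) := fun p => {u | u p.1 = ρ p.2}
  have hB₂ : ∀ p, (#(B₂ p) : ℝ) ≤ n⁻¹ * T := by
    rintro ⟨x, p⟩
    exact card_filter_apply_le (V := V) x (fun u v => v = ρ p) (fun u w v => Iff.rfl) n⁻¹
      (fun u => by convert hone (ρ p))
  set α := c' / (4 * (2 * K + L + 1)) with hα
  have hfew : ∀ (s : Finset V) (k : ℕ), #s ≤ k * a → (#s : ℝ) ≤ k * α * n := fun s k hs => by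
    calc (#s : ℝ) ≤ k * a := by exact_mod_cast hs
      _ ≤ k * (α * n) := by gcongr
      _ = _ := by ring
  obtain ⟨S₃, hS₃⟩ : ∃ S : Bool → (X → V) → Finset V, ∀ b u, S b u =
    {w ∈ G.twinSet ρ u b | #{v ∈ G.twinSet ρ u b | G.Adj w v} < K} := ⟨_, fun _ _ => rfl⟩
  let B₃ : Bool → Finset (X → V) := fun b => {u | u (apex r b, m b) ∈ S₃ b u}
  have hB₃ : ∀ b, (#(B₃ b) : ℝ) ≤ K * α * T := fun b => by
    refine card_filter_apply_mem_le (apex r b, m b) (S₃ b) (fun u w => ?_) _ (fun u => ?_)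
    · rw [hS₃, hS₃, twinSet_update]
    · rw [hS₃]
      exact hfew _ _ (G.card_filter_degree_lt_le ha K _)
  obtain ⟨S₄, hS₄⟩ : ∃ S : (X → V) → Finset V, ∀ u, S u =
    {w ∈ G.pathSet ρ u a₀ | ¬ ∃ q, G.IsPathSeq (G.pathSet ρ u a₀) L w q} := ⟨_, fun _ => rfl⟩
  obtain ⟨z, hz⟩ : ∃ z : X, z = (.inl 0, a₀) := ⟨_, rfl⟩
  let B₄ : Unit → Finset (X → V) := fun _ => {u | u z ∈ S₄ u}
  have hB₄ : ∀ b, (#(B₄ b) : ℝ) ≤ L * α * T := fun b => by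
    refine card_filter_apply_mem_le z S₄ (fun u w => ?_) _ (fun u => ?_)
    · rw [hS₄, hS₄, hz, pathSet_update]
    · rw [hS₄]
      exact hfew _ _ (G.card_filter_not_isPathSeq_le ha L _)
  obtain ⟨u, huU, hu⟩ := exists_mem_forall_notMem U
    (Sum.elim B₁ (Sum.elim B₂ (Sum.elim B₃ B₄))) (by
      refine lt_of_lt_of_le ?_ hU
      simp only [Fintype.sum_sum_type, Sum.elim_inl, Sum.elim_inr]
      have h1 := sum_le_card_nsmul univ (fun p => (#(B₁ p) : ℝ)) _ fun p _ => hB₁ p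
      have h2 := sum_le_card_nsmul univ (fun p => (#(B₂ p) : ℝ)) _ fun p _ => hB₂ p
      have h3 := sum_le_card_nsmul univ (fun p => (#(B₃ p) : ℝ)) _ fun p _ => hB₃ p
      have h4 := sum_le_card_nsmul univ (fun p => (#(B₄ p) : ℝ)) _ fun p _ => hB₄ p
      rw [card_univ, nsmul_eq_mul] at h1 h2 h3 h4
      have c1 : Fintype.card (X × X) = M * M := Fintype.card_prod X X
      have c2 : Fintype.card (X × (Bool × Fin r)) = M * (2 * r) := by
        rw [Fintype.card_prod X]
        change M * _ = _
        rw [Fintype.card_prod, Fintype.card_bool, Fintype.card_fin]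
      rw [c1] at h1
      rw [c2] at h2
      simp only [Fintype.card_bool, Fintype.card_unit] at h3 h4
      push_cast at h1 h2 h3 h4
      have e1 : (M * M + M * (2 * r)) * n⁻¹ ≤ c' / 4 := by
        rw [div_lt_iff₀ hc'] at hn1
        rw [← div_eq_mul_inv, div_le_iff₀ hn0]
        linarith
      have e2 : (2 * K + L) * α ≤ c' / 4 := by
        rw [hα, mul_div_assoc', div_le_iff₀ (by positivity)]
        nlinarith
      have e3 : ((M * M + M * (2 * r)) * n⁻¹ + (2 * K + L) * α) * T < c' * T := by
        refine mul_lt_mul_of_pos_right ?_ hT0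
        linarith
      refine lt_of_le_of_lt ?_ e3
      refine (add_le_add h1 (add_le_add h2 (add_le_add h3 h4))).trans (le_of_eq ?_)
      ring)
  have hu₁ : ∀ x y, x ≠ y → u x ≠ u y := fun x y hxy h => hu (.inl (x, y)) (by
    simp [B₁, h, hxy])
  have hu₂ : ∀ x p, u x ≠ ρ p := fun x p h => hu (.inr (.inl (x, p))) (by simp [B₂, h])
  have hinj : Injective u := fun x y h => by_contra fun hne => hu₁ x y hne h
  rw [hUdef, mem_filter] at huU
  have huA := huU.2
  refine ⟨u, exists_isStairEmbedding_of_generic G ρ m L u a₀ huA hinj hu₂ ?_ ?_⟩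
  · intro b F hF
    have h3 := hu (.inr (.inr (.inl b)))
    simp only [Sum.elim_inr, Sum.elim_inl, B₃, hS₃, mem_filter, mem_univ, true_and, not_and,
      not_lt] at h3
    have hmem : u (apex r b, m b) ∈ G.twinSet ρ u b := by
      simp only [twinSet, mem_filter, mem_univ, true_and]
      exact ⟨fun c => by simpa [back_apex] using huA (fun _ => m b) (apex r b) c,
        fun i a h _ => (IsStairHom.adj_of_forall huA a (m b) h).symm⟩
    have hcard := h3 hmem
    obtain ⟨w, hw, hwF⟩ := exists_mem_notMem_of_card_lt_card
      (lt_of_le_of_lt hF (lt_of_lt_of_le (Nat.lt_succ_self _) hcard))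
    rw [mem_filter] at hw
    exact ⟨w, hw.1, hw.2, hwF⟩
  · have h4 := hu (.inr (.inr (.inr ())))
    simp only [Sum.elim_inr, B₄, hS₄, hz, mem_filter, mem_univ, true_and, not_and, not_not] at h4
    refine h4 ?_
    simp only [pathSet, mem_filter, mem_univ, true_and]
    exact ⟨fun i a h => (IsStairHom.adj_of_forall huA a a₀ h).symm, hu₂ _,
      fun x hx => hu₁ _ _ hx.symm⟩

end SimpleGraph

/-! ### The linear order on the staircase -/

namespace StairLabel

/-- Vertices of the staircase sequence: clones of labels, path vertices and twins. -/
abbrev Vertex (r : ℕ) : Type := (StairLabel r × ℕ) ⊕ (ℕ ⊕ Bool)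

/-- The vertex in row `j` and slot `s` of side `b`, for the position `P` of the sequence. The
column `0` has the two slots `0` and `1`, every other column `c` has the slot `c + 1`. -/
def slot {r : ℕ} [NeZero r] (b : Bool) (j s P : ℕ) : Vertex r :=
  if s ≤ 1 then
    if j = 0 then if s = 0 then .inr (.inr b) else .inl (apex r b, P)
    else .inr (.inl (if b then 4 * r - 1 - (2 * (j - 1) + s) else 2 * (j - 1) + s))
  else .inl (entry b j (Fin.ofNat r (s - 1)), P)

theorem slot_twin {r : ℕ} [NeZero r] (b : Bool) (P : ℕ) :
    slot b 0 0 P = (.inr (.inr b) : Vertex r) := by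
  simp [slot]

theorem slot_apex {r : ℕ} [NeZero r] (b : Bool) (P : ℕ) :
    slot b 0 1 P = (.inl (apex r b, P) : Vertex r) := by
  simp [slot]

theorem slot_path {r : ℕ} [NeZero r] (b : Bool) {j s : ℕ} (hj : j ≠ 0) (hs : s ≤ 1) (P : ℕ) :
    slot b j s P = (.inr (.inl (if b then 4 * r - 1 - (2 * (j - 1) + s) else 2 * (j - 1) + s)) :
      Vertex r) := by
  rw [slot, if_pos hs, if_neg hj]

theorem slot_entry {r : ℕ} [NeZero r] (b : Bool) (j : ℕ) {s : ℕ} (hs : ¬ s ≤ 1) (P : ℕ) :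
    slot b j s P = (.inl (entry b j (Fin.ofNat r (s - 1)), P) : Vertex r) := by
  rw [slot, if_neg hs]

/-- The length of the staircase sequence. -/
def length (r : ℕ) : ℕ := 2 * (r * r) + 3 * r + 3

instance (r : ℕ) : NeZero (length r) := ⟨by unfold length; omega⟩

/-- The staircase sequence: it consists of the rows of the first side followed by the rows of the
second side in reverse order. -/
def seq (r : ℕ) [NeZero r] (P : ℕ) : Vertex r :=
  -- The bound is `(r + 1)² + 2`: rows `0` to `r` of the first side and two further path vertices.
  -- What remains is rows `0` to `r - 1` of the second side, so `4 * r` path vertices occur in all.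
  if P < r * r + 2 * r + 3 then slot false (P / (r + 1)) (P % (r + 1)) P
  else slot true ((length r - 1 - P) / (r + 1)) ((length r - 1 - P) % (r + 1)) P

theorem divMod_eq {r j s p : ℕ} (h : p = j * (r + 1) + s) (hs : s ≤ r) :
    p / (r + 1) = j ∧ p % (r + 1) = s := by
  subst h
  rw [mul_comm]
  exact ⟨by rw [Nat.mul_add_div (by omega), Nat.div_eq_of_lt (by omega), add_zero],
    by rw [Nat.mul_add_mod, Nat.mod_eq_of_lt (by omega)]⟩

theorem exists_eq_mul_add (r p : ℕ) : ∃ j s, p = j * (r + 1) + s ∧ s ≤ r :=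
  ⟨p / (r + 1), p % (r + 1), (Nat.div_add_mod' p (r + 1)).symm,
    Nat.lt_succ_iff.1 (Nat.mod_lt _ (by omega))⟩

theorem seq_eq_slot_false {r : ℕ} [NeZero r] {P j s : ℕ} (h : P = j * (r + 1) + s) (hs : s ≤ r)
    (hP : P < r * r + 2 * r + 3) : seq r P = slot false j s P := by
  rw [seq, if_pos hP, (divMod_eq h hs).1, (divMod_eq h hs).2]

theorem entry_zero {r : ℕ} [NeZero r] (b : Bool) {j : ℕ} (hj : j ≠ 0) :
    entry b j (0 : Fin r) = .inl 0 := by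
  rw [entry, dif_neg (by simpa using hj), core]
  simp

theorem entry_zero_zero {r : ℕ} [NeZero r] (b : Bool) : entry b 0 (0 : Fin r) = apex r b := by
  rw [entry, dif_pos (Nat.zero_le _)]
  rfl

theorem val_ofNat_sub_one {r : ℕ} [NeZero r] {s : ℕ} (h1 : 2 ≤ s) (hs : s ≤ r) :
    (Fin.ofNat r (s - 1) : ℕ) = s - 1 :=
  Nat.mod_eq_of_lt (by omega)

/-- Row `r` lies in the core outside column `0`. The columns `s - 1` and `r + 1 - s` sum to `r`, so
the sign in `core` identifies them. -/
theorem slot_false_eq_slot_true {r : ℕ} [NeZero r] {s : ℕ} (h1 : 2 ≤ s) (hs : s ≤ r)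
    (P : ℕ) : (slot false r s P : Vertex r) = slot true r (r + 2 - s) P := by
  rw [slot_entry _ _ (by omega), slot_entry _ _ (by omega)]
  have e1 := val_ofNat_sub_one (r := r) h1 hs
  have e2 := val_ofNat_sub_one (r := r) (s := r + 2 - s) (by omega) (by omega)
  rw [entry, entry, dif_neg (by omega), dif_neg (by omega), core, core]
  have : Fin.ofNat r (s - 1) = -Fin.ofNat r (r + 2 - s - 1) := by
    rw [eq_neg_iff_add_eq_zero]
    apply Fin.ext
    rw [Fin.val_add, e1, e2]
    have : s - 1 + (r + 2 - s - 1) = r := by omega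
    simp [this]
  rw [if_neg Bool.false_ne_true, if_pos rfl, this]

/-- Both descriptions are valid on an overlap of `r + 3` positions: the core row with two path
vertices on either side. Hence any two positions at distance at most `r` can be treated on one side.
-/
theorem seq_eq_slot_true {r : ℕ} [NeZero r] (hr : 2 ≤ r) {P j s : ℕ}
    (h : P + (j * (r + 1) + s) = length r - 1) (hs : s ≤ r) (hP : r * r + r ≤ P) :
    seq r P = slot true j s P := by
  by_cases hPN : P < r * r + 2 * r + 3
  · have hl : length r = 2 * (r * r) + 3 * r + 3 := rfl
    have hright : ∀ j' s', P + (j' * (r + 1) + s') = length r - 1 → s' ≤ r → j = j' ∧ s = s' := by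
      intro j' s' h' hs'
      have e : j * (r + 1) + s = j' * (r + 1) + s' := by omega
      have e1 := divMod_eq e hs'
      have e2 := divMod_eq (j := j) rfl hs
      rw [e2.1, e2.2] at e1
      exact e1
    obtain ⟨t, rfl⟩ := Nat.exists_eq_add_of_le hP
    have ht : t < r + 3 := by omega
    have hmul : (r + 1) * (r + 1) = r * r + 2 * r + 1 := by ring
    have hmul' : r * (r + 1) = r * r + r := by ring
    rcases Nat.lt_or_ge t 2 with h2 | h2
    · obtain ⟨rfl, rfl⟩ := hright (r + 1) (1 - t) (by omega) (by omega)
      rw [seq_eq_slot_false (j := r) (s := t) (by omega) (by omega) hPN,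
        slot_path _ (by omega) (by omega), slot_path _ (by omega) (by omega)]
      simp only [Bool.false_eq_true, if_false, if_true, Sum.inr.injEq, Sum.inl.injEq]
      omega
    rcases Nat.lt_or_ge t (r + 1) with h3 | h3
    · obtain ⟨rfl, rfl⟩ := hright r (r + 2 - t) (by omega) (by omega)
      rw [seq_eq_slot_false (j := j) (s := t) (by omega) (by omega) hPN]
      exact slot_false_eq_slot_true h2 (by omega) _
    · obtain ⟨rfl, rfl⟩ := hright r (r + 2 - t) (by omega) (by omega)
      rw [seq_eq_slot_false (j := j + 1) (s := t - (j + 1)) (by omega) (by omega) hPN,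
        slot_path _ (by omega) (by omega), slot_path _ (by omega) (by omega)]
      simp only [Bool.false_eq_true, if_false, if_true, Sum.inr.injEq, Sum.inl.injEq]
      omega
  · have e : length r - 1 - P = j * (r + 1) + s := by omega
    rw [seq, if_neg hPN, (divMod_eq e hs).1, (divMod_eq e hs).2]

/-- The position of a vertex in the staircase sequence. -/
def position (r : ℕ) : Vertex r → ℕ
  | .inl x => x.2
  | .inr (.inl k) =>
    if k < 2 * r + 2 then (k / 2 + 1) * (r + 1) + k % 2
    else length r - 1 - (((4 * r - 1 - k) / 2 + 1) * (r + 1) + (4 * r - 1 - k) % 2)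
  | .inr (.inr b) => if b then length r - 1 else 0

/-- A left inverse, giving distinctness of the sequence. For labels it is immediate, since the clone
index is the position. -/
theorem position_seq {r : ℕ} [NeZero r] (hr : 2 ≤ r) {P : ℕ} (hP : P < length r) :
    position r (seq r P) = P := by
  have hl : length r = 2 * (r * r) + 3 * r + 3 := rfl
  have hmul' : r * (r + 1) = r * r + r := by ring
  have hmul : (r + 2) * (r + 1) = r * r + 3 * r + 2 := by ring
  by_cases hPN : P < r * r + 2 * r + 3
  · obtain ⟨j, s, h, hs⟩ := exists_eq_mul_add r P
    rw [seq_eq_slot_false h hs hPN]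
    by_cases h1 : s ≤ 1
    · rcases eq_or_ne j 0 with rfl | h2
      · rcases Nat.le_one_iff_eq_zero_or_eq_one.1 h1 with rfl | rfl
        · rw [slot_twin, position, if_neg Bool.false_ne_true]
          omega
        · rw [slot_apex, position]
      · have hj : j < r + 2 := by
          by_contra! hj
          have := Nat.mul_le_mul_right (r + 1) hj
          omega
        have e1 : (2 * (j - 1) + s) / 2 + 1 = j := by omega
        have e2 : (2 * (j - 1) + s) % 2 = s := by omega
        have hk : 2 * (j - 1) + s < 2 * r + 2 := by
          have hj' : j = r + 1 → (r + 1) * (r + 1) + s < r * r + 2 * r + 3 := by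
            rintro rfl; omega
          omega
        rw [slot_path _ h2 h1, position, if_neg Bool.false_ne_true, if_pos hk, e1, e2, h]
    · rw [slot_entry _ _ h1, position]
  · obtain ⟨j, s, h, hs⟩ := exists_eq_mul_add r (length r - 1 - P)
    have hj : j < r := by
      by_contra! hj
      have := Nat.mul_le_mul_right (r + 1) hj
      omega
    rw [seq_eq_slot_true hr (j := j) (s := s) (by omega) hs (by omega)]
    by_cases h1 : s ≤ 1
    · rcases eq_or_ne j 0 with rfl | h2
      · rcases Nat.le_one_iff_eq_zero_or_eq_one.1 h1 with rfl | rfl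
        · rw [slot_twin, position, if_pos rfl]
          omega
        · rw [slot_apex, position]
      · have e0 : 4 * r - 1 - (4 * r - 1 - (2 * (j - 1) + s)) = 2 * (j - 1) + s := by omega
        have e1 : (2 * (j - 1) + s) / 2 + 1 = j := by omega
        have e2 : (2 * (j - 1) + s) % 2 = s := by omega
        rw [slot_path _ h2 h1, position, if_pos rfl, if_neg (by omega), e0, e1, e2]
        omega
    · rw [slot_entry _ _ h1, position]

/-- The vertices of a blown-up staircase, as vertices of the sequence. -/
def ofIndex {r : ℕ} : (StairLabel r × Fin (length r)) ⊕ (Fin (4 * r) ⊕ Bool) → Vertex r :=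
  Sum.map (fun x => (x.1, x.2)) (Sum.map (fun k => k) id)

theorem exists_ofIndex_eq_seq {r : ℕ} [NeZero r] (hr : 2 ≤ r) {P : ℕ} (hP : P < length r) :
    ∃ x, ofIndex x = seq r P := by
  have hl : length r = 2 * (r * r) + 3 * r + 3 := rfl
  have hmul : (r + 2) * (r + 1) = r * r + 3 * r + 2 := by ring
  have key : ∀ b j s, (b = false → j < r + 2) → ∃ x, ofIndex x = (slot b j s P : Vertex r) := by
    intro b j s hj
    rw [slot]
    split_ifs with h1 h2 h3 h4
    · exact ⟨.inr (.inr b), rfl⟩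
    · exact ⟨.inl (_, ⟨P, hP⟩), rfl⟩
    · exact ⟨.inr (.inl ⟨4 * r - 1 - (2 * (j - 1) + s), by omega⟩), rfl⟩
    · have := hj (by simpa using h4)
      exact ⟨.inr (.inl ⟨2 * (j - 1) + s, by omega⟩), rfl⟩
    · exact ⟨.inl (_, ⟨P, hP⟩), rfl⟩
  rw [seq]
  split_ifs with h
  · refine key _ _ _ fun _ => Nat.div_lt_of_lt_mul ?_
    rw [mul_comm]
    omega
  · exact key _ _ _ (by simp)

end StairLabel

/-! ### The staircase sequence is a connecting path -/

namespace SimpleGraph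

open StairLabel

/-- The vertex of the graph at a vertex of the staircase sequence. -/
def stairVertex {V : Type*} {r : ℕ} (u : StairLabel r × Fin (length r) → V) (q : ℕ → V)
    (d : Bool → V) : Vertex r → V :=
  Sum.elim (fun x => u (x.1, Fin.ofNat (length r) x.2)) (Sum.elim q d)

theorem stairVertex_ofIndex {V : Type*} {r : ℕ} (u : StairLabel r × Fin (length r) → V)
    (q : ℕ → V) (d : Bool → V) (x) :
    stairVertex u q d (ofIndex x) = Sum.elim u (Sum.elim (fun k : Fin (4 * r) => q k) d) x := by
  rcases x with ⟨i, a⟩ | k | b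
  · simp [stairVertex, ofIndex]
  · rfl
  · rfl

variable {V : Type*} {G : SimpleGraph V} {r : ℕ} [NeZero r] {ρ : Bool × Fin r → V}
  {m : Bool → Fin (length r)} {u : StairLabel r × Fin (length r) → V} {q : ℕ → V} {d : Bool → V}

theorem IsStairEmbedding.adj_slot_same (h : G.IsStairEmbedding ρ m (4 * r) u q d)
    {b : Bool} {j s s' P P' : ℕ} (hj : j ≤ r + 1) (hs : s < s') (hs' : s' ≤ r)
    (hm : j = 0 → s' = 1 → Fin.ofNat (length r) P' = m b) :
    G.Adj (stairVertex u q d (slot b j s P)) (stairVertex u q d (slot b j s' P')) := by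
  by_cases h1 : s' ≤ 1
  · obtain rfl : s = 0 := by omega
    obtain rfl : s' = 1 := by omega
    by_cases hj0 : j = 0
    · subst hj0
      rw [slot_twin, slot_apex]
      change G.Adj (d b) (u (apex r b, Fin.ofNat (length r) P'))
      rw [hm rfl rfl]
      exact h.twin_adj b
    · have hr := NeZero.pos r
      cases b
      · simpa [slot, stairVertex, hj0] using h.path_adj (2 * (j - 1)) (by omega)
      · have := h.path_adj (4 * r - 1 - (2 * (j - 1) + 1)) (by omega)
        rw [show 4 * r - 1 - (2 * (j - 1) + 1) + 1 = 4 * r - 1 - 2 * (j - 1) by omega] at this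
        simpa [slot, stairVertex, hj0] using this.symm
  · have e' := val_ofNat_sub_one (r := r) (s := s') (by omega) hs'
    have h0 : (0 : Fin r) < Fin.ofNat r (s' - 1) := by
      rw [Fin.lt_def, e', Fin.val_zero]; omega
    have hrel := rel_entry_entry b j h0
    by_cases h2 : s ≤ 1
    · by_cases hj0 : j = 0
      · subst hj0
        rw [entry_zero_zero] at hrel
        by_cases h3 : s = 0
        · have hne : entry b 0 (Fin.ofNat r (s' - 1)) ≠ .inl 0 := by
            rw [entry, dif_pos (Nat.zero_le _)]; simp
          simpa [slot, stairVertex, h1, h3] using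
            (h.adj_twin _ (Fin.ofNat (length r) P') b hrel.symm hne).symm
        · simpa [slot, stairVertex, h1, h2, h3] using h.adj _ _ _ _ hrel
      · rw [entry_zero b hj0] at hrel
        have hr := NeZero.pos r
        rw [slot_path _ hj0 h2, slot_entry _ _ h1]
        exact (h.adj_path _ _ _ hrel.symm (by split_ifs <;> omega)).symm
    · have e := val_ofNat_sub_one (r := r) (s := s) (by omega) (by omega)
      have hlt : Fin.ofNat r (s - 1) < Fin.ofNat r (s' - 1) := by
        rw [Fin.lt_def, e, e']; omega
      rw [slot_entry _ _ h2, slot_entry _ _ h1]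
      exact h.adj _ _ _ _ (rel_entry_entry b j hlt)

/-- Slots in consecutive rows are at distance at most `r` exactly when `s' < s`. They share a column
only for `s = 1` and `s' = 0`, where the edge is one of the path or joins the first entry to the
path. The twin in slot `0` never has to see the path. -/
theorem IsStairEmbedding.adj_slot_succ (h : G.IsStairEmbedding ρ m (4 * r) u q d) (hr : 2 ≤ r)
    {b : Bool} {j s s' P P' : ℕ} (hj : j ≤ r) (hs : s' < s) (hs' : s ≤ r) :
    G.Adj (stairVertex u q d (slot b j s P)) (stairVertex u q d (slot b (j + 1) s' P')) := by
  by_cases h1 : s ≤ 1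
  · obtain rfl : s' = 0 := by omega
    obtain rfl : s = 1 := by omega
    by_cases hj0 : j = 0
    · subst hj0
      rw [slot_apex, slot_path _ (by omega) (by omega)]
      exact h.adj_path _ _ _ (rel_apex_zero hr b) (by split_ifs <;> omega)
    · cases b
      · have := h.path_adj (2 * (j - 1) + 1) (by omega)
        rw [show 2 * (j - 1) + 1 + 1 = 2 * j by omega] at this
        simpa [slot, stairVertex, hj0] using this
      · have := h.path_adj (4 * r - 1 - 2 * j) (by omega)
        rw [show 4 * r - 1 - 2 * j + 1 = 4 * r - 1 - (2 * (j - 1) + 1) by omega] at this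
        simpa [slot, stairVertex, hj0] using this.symm
  · have e := val_ofNat_sub_one (r := r) (s := s) (by omega) hs'
    by_cases h2 : s' ≤ 1
    · have h0 : (0 : Fin r) < Fin.ofNat r (s - 1) := by
        rw [Fin.lt_def, e, Fin.val_zero]; omega
      have hrel := rel_entry_entry_succ b j h0
      rw [entry_zero b (by omega)] at hrel
      rw [slot_path _ (Nat.succ_ne_zero j) h2, slot_entry _ _ h1]
      exact h.adj_path _ _ _ hrel (by split_ifs <;> omega)
    · have e' := val_ofNat_sub_one (r := r) (s := s') (by omega) (by omega)
      have hlt : Fin.ofNat r (s' - 1) < Fin.ofNat r (s - 1) := by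
        rw [Fin.lt_def, e, e']; omega
      rw [slot_entry _ _ h2, slot_entry _ _ h1]
      exact h.adj _ _ _ _ (rel_entry_entry_succ b j hlt)

theorem IsStairEmbedding.adj_root_slot (h : G.IsStairEmbedding ρ m (4 * r) u q d)
    {b : Bool} {s P : ℕ} {c : Fin r} (hs : s ≤ c) :
    G.Adj (ρ (b, c)) (stairVertex u q d (slot b 0 s P)) := by
  by_cases h1 : s ≤ 1
  · by_cases h0 : s = 0
    · simpa [slot, stairVertex, h0] using (h.twin_root b c).symm
    · simpa [slot, stairVertex, h0, h1] using (h.adj_root _ c _ _ (back_apex b c)).symm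
  · have e := val_ofNat_sub_one (r := r) (s := s) (by omega) (by omega)
    have hlt : Fin.ofNat r (s - 1) < c := by rw [Fin.lt_def, e]; omega
    rw [slot_entry _ _ h1]
    exact (h.adj_root _ c _ _ (back_entry_zero b hlt)).symm

/-- Adjacency in the staircase sequence, in terms of the positions `p < p'` on side `b`. -/
theorem IsStairEmbedding.exists_adj_slot (h : G.IsStairEmbedding ρ m (4 * r) u q d) (hr : 2 ≤ r)
    (b : Bool) {p p' : ℕ} (hlt : p < p') (hle : p' ≤ p + r) (hN : p' < r * r + 2 * r + 3) :
    ∃ j s j' s', p = j * (r + 1) + s ∧ s ≤ r ∧ p' = j' * (r + 1) + s' ∧ s' ≤ r ∧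
      ∀ P P', (p' = 1 → Fin.ofNat (length r) P' = m b) →
        G.Adj (stairVertex u q d (slot b j s P)) (stairVertex u q d (slot b j' s' P')) := by
  obtain ⟨j, s, hp, hs⟩ := exists_eq_mul_add r p
  have hmul : (r + 2) * (r + 1) = r * r + 3 * r + 2 := by ring
  by_cases hrow : s + (p' - p) ≤ r
  · have hj : j < r + 2 := by
      by_contra! hj
      have := Nat.mul_le_mul_right (r + 1) hj
      omega
    refine ⟨j, s, j, s + (p' - p), hp, hs, by omega, hrow, fun P P' hm => ?_⟩
    refine h.adj_slot_same (by omega) (by omega) hrow fun hj0 h1 => hm ?_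
    subst hj0
    omega
  · have hp' : p' = (j + 1) * (r + 1) + (s + (p' - p) - (r + 1)) := by
      rw [Nat.succ_mul]
      omega
    have hj : j + 1 < r + 2 := by
      by_contra! hj
      have := Nat.mul_le_mul_right (r + 1) hj
      omega
    exact ⟨j, s, j + 1, s + (p' - p) - (r + 1), hp, hs, hp', by omega, fun P P' _ =>
      h.adj_slot_succ hr (by omega) (by omega) hs⟩

/-- The second side is read from the end, hence the reversal of `y`. The distinguished clones `1`
and `length r - 2` are the positions of the first entries next to their twins. -/
theorem IsStairEmbedding.isConnectingRPath (hr : 2 ≤ r) {x y : Fin r → V}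
    (h : G.IsStairEmbedding (fun p : Bool × Fin r => if p.1 then y (Fin.rev p.2) else x p.2)
      (fun b => if b then Fin.ofNat (length r) (length r - 2) else Fin.ofNat (length r) 1)
      (4 * r) u q d) :
    G.IsConnectingRPath x y fun P : Fin (length r) => stairVertex u q d (seq r P) := by
  have hl : length r = 2 * (r * r) + 3 * r + 3 := rfl
  have hvert : ∀ P : Fin (length r), ∃ z, ofIndex z = seq r P ∧ stairVertex u q d (seq r P) =
      Sum.elim u (Sum.elim (fun k : Fin (4 * r) => q k) d) z := fun P => by
    obtain ⟨z, hz⟩ := exists_ofIndex_eq_seq hr P.2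
    exact ⟨z, hz, by rw [← hz, stairVertex_ofIndex]⟩
  refine ⟨⟨fun P Q hPQ => ?_, fun P Q hPQ hQ => ?_⟩, by omega, ?_, ?_, fun i j hij => ?_,
    fun i j hij => ?_⟩
  · obtain ⟨z, hz, hz'⟩ := hvert P
    obtain ⟨w, hw, hw'⟩ := hvert Q
    simp only [hz', hw'] at hPQ
    have e := congrArg (position r) (congrArg ofIndex (h.injective hPQ))
    rw [hz, hw, position_seq hr P.2, position_seq hr Q.2] at e
    exact Fin.ext e
  · rw [Fin.lt_def] at hPQ
    by_cases hQN : (Q : ℕ) < r * r + 2 * r + 3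
    · obtain ⟨j, s, j', s', hp, hs, hp', hs', hadj⟩ := h.exists_adj_slot hr false hPQ hQ hQN
      rw [seq_eq_slot_false hp hs (by omega), seq_eq_slot_false hp' hs' hQN]
      exact hadj _ _ (by rintro h1; simp [h1])
    · have hP2 := P.2
      have hQ2 := Q.2
      obtain ⟨j, s, j', s', hp, hs, hp', hs', hadj⟩ := h.exists_adj_slot hr true
        (p := length r - 1 - Q) (p' := length r - 1 - P) (by omega) (by omega) (by omega)
      rw [seq_eq_slot_true hr (P := P) (j := j') (s := s') (by omega) hs' (by omega),
        seq_eq_slot_true hr (P := Q) (j := j) (s := s) (by omega) hs (by omega)]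
      refine (hadj _ _ fun h1 => ?_).symm
      have : (P : ℕ) = length r - 2 := by omega
      simp [this]
  · rw [Set.disjoint_left]
    rintro _ ⟨P, rfl⟩ ⟨c, hc⟩
    obtain ⟨z, -, hz'⟩ := hvert P
    refine h.ne_root z (false, c) ?_
    rw [← hz']
    simpa using hc.symm
  · rw [Set.disjoint_left]
    rintro _ ⟨P, rfl⟩ ⟨c, hc⟩
    obtain ⟨z, -, hz'⟩ := hvert P
    refine h.ne_root z (true, Fin.rev c) ?_
    rw [← hz']
    simpa using hc.symm
  · have hi := i.2
    have := h.adj_root_slot (b := false) (s := i) (P := i) (c := j) hij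
    rw [← seq_eq_slot_false (j := 0) (P := i) (by omega) (by omega) (by omega)] at this
    simpa using this
  · have hj := j.2
    have hi := i.2
    have := h.adj_root_slot (b := true) (s := length r - 1 - j) (P := j) (c := Fin.rev i)
      (by rw [Fin.val_rev]; omega)
    rw [← seq_eq_slot_true hr (j := 0) (P := j) (by omega) (by omega) (by omega)] at this
    simpa using this.symm

end SimpleGraph

theorem mainTheorem2 (r : ℕ) (hr : 2 ≤ r) (μ : ℝ) (hμ : 0 < μ) :
    ∃ α : ℝ, 0 < α ∧ ∃ n₀ : ℕ,
      ∀ (V : Type*) [Fintype V] (G : SimpleGraph V) [DecidableRel G.Adj],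
        n₀ ≤ Fintype.card V →
        (1 - 1 / (r : ℝ) + μ) * (Fintype.card V : ℝ) ≤ (G.minDegree : ℝ) →
        (G.indepNum : ℝ) ≤ α * (Fintype.card V : ℝ) →
        ∀ x y : Fin r → V, G.IsCliqueTuple x → G.IsCliqueTuple y →
          Disjoint (Set.range x) (Set.range y) →
          ∃ (l : ℕ) (v : Fin l → V), l ≤ 200 * r ^ 5 ∧ G.IsConnectingRPath x y v := by
  have : NeZero r := ⟨by omega⟩
  obtain ⟨α, hα, n₀, h⟩ := SimpleGraph.exists_isStairEmbedding r (Fin (StairLabel.length r))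
    (fun b => if b then Fin.ofNat (StairLabel.length r) (StairLabel.length r - 2)
      else Fin.ofNat (StairLabel.length r) 1) (4 * r) (c := r * μ) (by positivity)
  refine ⟨α, hα, n₀, fun V _ G _ hn hdeg hind x y _ _ _ => ?_⟩
  have hcommon : ∀ g : Fin r → V,
      r * μ * Fintype.card V ≤ Nat.card {w : V // ∀ j, G.Adj w (g j)} := fun g => by
    classical
    rw [Nat.card_eq_fintype_card, Fintype.card_subtype]
    refine (G.le_card_commonNeighbors (by omega) (fun v => hdeg.trans ?_) g).trans (le_of_eq ?_)
    · have h1 : (G.minDegree : ℝ) ≤ G.degree v := by exact_mod_cast G.minDegree_le_degree v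
      refine h1.trans (le_of_eq ?_)
      rw [← SimpleGraph.card_neighborFinset_eq_degree, Nat.cast_inj]
      congr 1
      ext w
      simp [SimpleGraph.adj_comm]
    · congr
  obtain ⟨u, q, d, hu⟩ := h V G G.indepNum hn hcommon (fun I hI => hI.card_le_indepNum) hind
    (fun p => if p.1 then y (Fin.rev p.2) else x p.2)
  refine ⟨_, _, ?_, hu.isConnectingRPath hr⟩
  have h1 : r * r ≤ r ^ 5 := by
    rw [← sq]; exact Nat.pow_le_pow_right (by omega) (by norm_num)
  have h2 : r ≤ r * r := Nat.le_mul_self r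
  unfold StairLabel.length
  omega
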